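/- For nonnegative integers $r, s$, not both zero, an $(r,s)$-leaper is a piece that can move from a square $a$ of the infinite chessboard $\mathbb{Z}^2$ to any of the squares $a + (\pm r, \pm s)$, $a + (\pm s, \pm r)$; the $(r,s)$-leaper and the $(s,r)$-leaper are the same piece. Its leaper graph over a set $B$ of squares has the squares of $B$ as vertices and joins two squares when they are joined by a move. Let $L$ be a $(p,q)$-leaper with $p+q$ odd, and let $C$ be a cycle of the leaper graph of $L$ over a $(p+q)\times(p+q)$ chessboard $B$. Then there exists an $(r,s)$-leaper $M$, distinct from $L$, such that the leaper graph of $M$ over the set of squares of $C$ has a Hamiltonian cycle. Moreover, $M$ and a Hamiltonian cycle $D$ of $M$ over the squares of $C$ can be chosen so that $r+s<p+q$ and $D$ is proper in the following sense. Let $m=\min(p,q)$, $n=\max(p,q)$, and let $F$ be the $(m,n)$-frame obtained from $B$ by removing its central $(n-m)\times(n-m)$ squares. Extending the sides of the central hole dissects $F$ into eight rectangular sections $F_0,\dots,F_7$, lying in the directions E, NE, N, NW, W, SW, S, SE from the hole (indices are modulo $8$). The cycle $D$ is proper if, up to the choice of its starting square and orientation, it is a concatenation $D=a^0a^1\cdots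 a^7$ of eight disjoint nonempty paths such that, for every $i$, the path $a^i$ lies within $F_i$, and the translation by a move of $L$ that maps $F_i\cup F_{i+1}$ onto $F_{i+4}\cup F_{i+5}$ (for $i=0,\dots,7$ the translation by $(-n,-m)$, $(-m,-n)$, $(m,-n)$, $(n,-m)$, $(n,m)$, $(m,n)$, $(-m,n)$, $(-n,m)$, respectively) maps the path $a^ia^{i+1}$, square by square, onto the path obtained by traversing $a^{i+5}$ in reverse and then $a^{i+4}$ in reverse. -/

import Mathlib

/-- A square of the infinite chessboard, given by its integer coordinates. -/
abbrev Square : Type := ℤ × ℤ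

/-- A leaper with proportions `p` and `q`, not both zero. -/
structure Leaper where
  p : ℕ
  q : ℕ
  pos : 0 < p ∨ 0 < q

namespace Leaper

/-- The leaper `L` can move from `a` to `b`: `b` is one of the squares
`a + (± p, ± q)`, `a + (± q, ± p)`. -/
def IsMove (L : Leaper) (a b : Square) : Prop :=
  (|b.1 - a.1| = (L.p : ℤ) ∧ |b.2 - a.2| = (L.q : ℤ)) ∨
    (|b.1 - a.1| = (L.q : ℤ) ∧ |b.2 - a.2| = (L.p : ℤ))

/-- The leaper graph of `L` over the board `B`: its vertices are the squares of `B`, and its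
edges join the pairs of squares of `B` that are joined by a move of `L`. -/
def graph (L : Leaper) (B : Set Square) : SimpleGraph B where
  Adj a b := L.IsMove a b
  symm := ⟨fun a b h => by
    unfold IsMove at h ⊢
    rwa [abs_sub_comm a.1.1, abs_sub_comm a.1.2]⟩
  loopless := ⟨fun a h => by
    have hp := L.pos
    simp only [IsMove, sub_self, abs_zero] at h
    omega⟩

/-- Two leapers are the same piece if they have the same proportions up to order. -/
def SamePiece (L M : Leaper) : Prop :=
  (L.p = M.p ∧ L.q = M.q) ∨ (L.p = M.q ∧ L.q = M.p)

end Leaper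

/-- The `k × k` chessboard whose southwest corner square is `o`. -/
def regularBoard (o : Square) (k : ℕ) : Set Square :=
  {x | (o.1 ≤ x.1 ∧ x.1 < o.1 + k) ∧ (o.2 ≤ x.2 ∧ x.2 < o.2 + k)}

/-- The set of squares visited by a walk in a graph whose vertices are squares. -/
def squaresOf {B : Set Square} {G : SimpleGraph B} {a b : B} (C : G.Walk a b) : Set Square :=
  {x | ∃ y ∈ C.support, (y : Square) = x}

/-- The eight directions `E, NE, N, NW, W, SW, S, SE`, numbered `0, …, 7` counterclockwise, as
pairs of signs. The direction opposite to `i` is `i + 4`. -/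
def dir : Fin 8 → ℤ × ℤ :=
  ![(1, 0), (1, 1), (0, 1), (-1, 1), (-1, 0), (-1, -1), (0, -1), (1, -1)]

/-- The interval `[0, m + n)` is cut into `[0, m)` (sign `-1`), `[m, n)` (sign `0`), which is the
extent of the hole of an `(m, n)`-frame, and `[n, m + n)` (sign `1`). -/
def third (m n : ℕ) (e : ℤ) : Set ℤ :=
  if e < 0 then Set.Ico 0 (m : ℤ)
  else if e = 0 then Set.Ico (m : ℤ) n
  else Set.Ico (n : ℤ) (m + n)

/-- The section in direction `i` of the `(m, n)`-frame, `m < n`, whose southwest corner square is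
`o`: one of the eight rectangles into which the `(m + n) × (m + n)` board with its central
`(n - m) × (n - m)` hole removed is dissected when the sides of the hole are extended. -/
def frameSection (o : Square) (m n : ℕ) (i : Fin 8) : Set Square :=
  {x | x.1 - o.1 ∈ third m n (dir i).1 ∧ x.2 - o.2 ∈ third m n (dir i).2}

/-- The translation by a move of the `(m, n)`-leaper which maps the union of the sections `i` and
`i + 1` of an `(m, n)`-frame onto the union of the opposite sections `i + 5` and `i + 4`. -/
def crossing (m n : ℕ) : Fin 8 → ℤ × ℤ :=
  ![(-n, -m), (-m, -n), (m, -n), (n, -m), (n, m), (m, n), (-m, n), (-n, m)]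

/-- The closed walk `D`, whose squares are listed without repetition of the starting point as
`D.support.dropLast`, is proper in the `(m, n)`-frame with southwest corner square `o`: up to the
choice of a starting point and of an orientation, it is the concatenation of eight nonempty paths
`w 0, …, w 7`, the path `w i` in the section `i`, such that for every `i` the translation
`crossing m n i` maps `w i` followed by `w (i + 1)` onto the reverse of `w (i + 5)` followed by the
reverse of `w (i + 4)`. -/
def IsProper {B : Set Square} {G : SimpleGraph B} {b : B} (o : Square) (m n : ℕ)
    (D : G.Walk b b) : Prop :=
  ∃ w : Fin 8 → List Square,
    ((List.ofFn w).flatten.IsRotated (D.support.dropLast.map Subtype.val) ∨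
      (List.ofFn w).flatten.reverse.IsRotated (D.support.dropLast.map Subtype.val)) ∧
    (∀ i, w i ≠ []) ∧
    (∀ i, ∀ x ∈ w i, x ∈ frameSection o m n i) ∧
    ∀ i, (w i ++ w (i + 1)).map (fun x => x + crossing m n i) =
      (w (i + 5)).reverse ++ (w (i + 4)).reverse

/-! On the board a square of the section `F k` has no neighbours under `L` besides its translates by
`c k` and `c (k + 7)`, and a square of the hole has none. A vertex of a cycle has two neighbours on
it, so the squares of `C` form a full orbit of the crossings. It thus suffices to put every square
of an `(m, n)`-frame, `m + n` odd, into a `ProperSystem`: eight lists, chained by moves of a smaller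
leaper, compatible with the crossings, whose squares form one orbit (`exists_properSystem`).

This goes by strong induction on `m + n`, a descent in the manner of Euclid. The base is a translate
of `octagon`: its eight vertices are a cycle of `L` in the order given by steps of 5, and a cycle of
the `(|2m - n|, m)`-leaper in their natural order. The squares of the frame outside such octagons
belong to copies of sections of a smaller frame, with proportions `m` and `d = |n - 2m|`, the copies
in `F i` being translated by `τ i = octagon i`. Most crossings carry a copy of a square to another
copy of the same square; the others realise a crossing of the smaller frame. Hence a proper system
of the smaller frame lifts to one of the large frame (`ProperSystem.alternatingLift`,
`ProperSystem.wideLift`). The leaper `M` never changes under lifting, since its moves are invariant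
under translation and reversal. -/

/-! ### Translation, reversal and gluing of chains. -/

/-- The list of the translates by `t` of the squares of `l`. -/
def shift (t : Square) (l : List Square) : List Square := l.map (fun x => x + t)

lemma shift_append (t : Square) (k l : List Square) :
    shift t (k ++ l) = shift t k ++ shift t l := List.map_append

lemma shift_reverse (t : Square) (l : List Square) :
    shift t l.reverse = (shift t l).reverse := List.map_reverse

lemma shift_shift (s t : Square) (l : List Square) : shift s (shift t l) = shift (t + s) l := by
  simp [shift, Function.comp_def, add_assoc]

lemma mem_shift {t x : Square} {l : List Square} : x ∈ shift t l ↔ ∃ y ∈ l, y + t = x :=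
  List.mem_map

lemma shift_ne_nil {t : Square} {l : List Square} (h : l ≠ []) : shift t l ≠ [] := by
  simpa [shift] using h

lemma nodup_shift {t : Square} {l : List Square} (h : l.Nodup) : (shift t l).Nodup :=
  h.map (add_left_injective t)

lemma isChain_shift {R : Square → Square → Prop} (hR : ∀ x y t, R x y → R (x + t) (y + t))
    {t : Square} {l : List Square} (h : l.IsChain R) : (shift t l).IsChain R :=
  (List.isChain_map _).2 (h.imp fun x y => hR x y t)

lemma isChain_reverse_of_symm {R : Square → Square → Prop} (hs : ∀ x y, R x y → R y x)
    {l : List Square} (h : l.IsChain R) : l.reverse.IsChain R :=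
  List.isChain_reverse.2 (h.imp hs)

/-- Two chains that overlap in a nonempty list glue to a chain. -/
lemma isChain_glue {R : Square → Square → Prop} {x y z : List Square} (hy : y ≠ [])
    (h₁ : (x ++ y).IsChain R) (h₂ : (y ++ z).IsChain R) : (x ++ (y ++ z)).IsChain R := by
  rw [← List.append_assoc]
  exact h₁.append_overlap h₂ hy

/-! ### Proper systems and the lifting of orbits. -/

/-- A cyclic sequence of eight lists of squares `w i`, the list `w i` within the section `F i`,
such that the translations `c i` act on it as in a proper cycle, consecutive squares are related
by `R`, and the squares of the sequence form a single orbit of the translations `c i`, each acting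
on `F i ∪ F (i + 1)`. -/
structure ProperSystem (F : Fin 8 → Set Square) (c : Fin 8 → Square)
    (R : Square → Square → Prop) (w : Fin 8 → List Square) : Prop where
  ne_nil : ∀ i, w i ≠ []
  mem : ∀ i, ∀ x ∈ w i, x ∈ F i
  nodup : ∀ i, (w i).Nodup
  cross : ∀ i, shift (c i) (w i ++ w (i + 1)) = (w (i + 5)).reverse ++ (w (i + 4)).reverse
  chain : ∀ i, (w i ++ w (i + 1)).IsChain R
  orbit : ∀ T : Square → Prop, (∀ i, ∀ x ∈ F i ∪ F (i + 1), T x → T (x + c i)) →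
    (∃ i, ∃ x ∈ w i, T x) → ∀ i, ∀ x ∈ w i, T x

lemma ProperSystem.cross_reverse {F c R w} (h : ProperSystem F c R w) (i : Fin 8) :
    w (i + 4) ++ w (i + 5) = shift (c i) ((w (i + 1)).reverse ++ (w i).reverse) := by
  have := congrArg List.reverse (h.cross i)
  rw [← shift_reverse] at this
  simpa using this.symm

/-- If every section `F' j` is translated by `τ i` into `F i` whenever `J i j`, then the squares of
a proper system in `F'`, translated accordingly, are in a single orbit. -/
lemma ProperSystem.orbit_lift {F F' : Fin 8 → Set Square} {c c' τ : Fin 8 → Square}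
    {R : Square → Square → Prop} {b : Fin 8 → List Square} (hb : ProperSystem F' c' R b)
    (J : Fin 8 → Fin 8 → Prop)
    (hJ : ∀ i j, J i j → ∀ y ∈ F' j, y + τ i ∈ F i)
    (h5 : ∀ i, τ i + c i = τ (i + 5)) (h4 : ∀ i, τ (i + 1) + c i = τ (i + 4))
    (hlink : ∀ j, ∀ S : Fin 8 → Prop,
      (∀ i, J i j → S i → S (i + 5)) → (∀ i, J (i + 1) j → S (i + 1) → S (i + 4)) →
      (∃ i, J i j ∧ S i) → ∀ i, J i j → S i)
    (hex : ∀ j, ∃ i k l, J i j ∧ J i (j + 1) ∧ J l (j + 4) ∧ J l (j + 5) ∧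
      (i = k ∨ i = k + 1) ∧ τ i + c k = c' j + τ l)
    (hdisj : ∀ j, ∀ y ∈ F' j ∪ F' (j + 1), y + c' j ∈ F' (j + 4) ∪ F' (j + 5))
    (hF' : ∀ i j x, x ∈ F' i → x ∈ F' j → i = j)
    (T : Square → Prop) (hT : ∀ i, ∀ x ∈ F i ∪ F (i + 1), T x → T (x + c i))
    (h0 : ∃ i j, J i j ∧ ∃ y ∈ b j, T (y + τ i)) :
    ∀ i j, J i j → ∀ y ∈ b j, T (y + τ i) := by
  -- By `h5` and `h4` a crossing takes the copy of `y` by `τ i` to a copy of the same `y`; `hlink`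
  -- says that these crossings connect all copies of `y`.
  have link : ∀ j, ∀ y ∈ F' j, (∃ i, J i j ∧ T (y + τ i)) → ∀ i, J i j → T (y + τ i) := by
    intro j y hy
    refine hlink j (fun i => T (y + τ i)) ?_ ?_
    · intro i hi h
      have := hT i _ (Or.inl (hJ i j hi y hy)) h
      rwa [add_assoc, h5] at this
    · intro i hi h
      have := hT i _ (Or.inr (hJ _ j hi y hy)) h
      rwa [add_assoc, h4] at this
  have main := hb.orbit (fun y => ∃ i j, J i j ∧ y ∈ F' j ∧ T (y + τ i)) ?_ ?_
  · intro i j hij y hy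
    obtain ⟨i', j', hij', hy', h⟩ := main j y hy
    obtain rfl := hF' _ _ _ hy' (hb.mem j y hy)
    exact link j' y hy' ⟨i', hij', h⟩ i hij
  · rintro j y hy ⟨i', j', hij', hy', h⟩
    -- The crossing `c k` leaves the copies of `y`: it takes the copy by `τ i` to the copy of `y +
    -- c' j` by `τ l`.
    obtain ⟨i, k, l, hi0, hi1, hl4, hl5, hk, e⟩ := hex j
    have key : J i j' := by
      rcases hy with hy | hy
      · rwa [hF' _ _ _ hy' hy]
      · rwa [hF' _ _ _ hy' hy]
    have hi := link j' y hy' ⟨i', hij', h⟩ i key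
    have hmem := hJ i j' key y hy'
    have : T (y + τ i + c k) := by
      rcases hk with rfl | rfl
      · exact hT _ _ (Or.inl hmem) hi
      · exact hT _ _ (Or.inr hmem) hi
    rw [add_assoc, e, ← add_assoc] at this
    rcases hdisj j y hy with h4 | h5
    · exact ⟨l, _, hl4, h4, this⟩
    · exact ⟨l, _, hl5, h5, this⟩
  · obtain ⟨i, j, hij, y, hy, h⟩ := h0
    exact ⟨j, y, hy, i, j, hij, hb.mem j y hy, h⟩

/-! ### The alternating lift. -/

/-- The lists that make up the lift of a proper system `b`: the list `b i` where `e i` is false and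
three consecutive lists, reversed, where `e i` is true. -/
def alternatingLift (e : Fin 8 → Bool) (τ : Fin 8 → Square) (b : Fin 8 → List Square) (i : Fin 8) :
    List Square :=
  shift (τ i) (if e i then (b (i + 3) ++ (b (i + 4) ++ b (i + 5))).reverse else b i)

/-- The section `i` receives a translate of the section `j` in an alternating lift. -/
def AlternatingIndex (e : Fin 8 → Bool) (i j : Fin 8) : Prop :=
  if e i then j = i + 3 ∨ j = i + 4 ∨ j = i + 5 else j = i

lemma mem_alternatingLift {e τ b i x} :
    x ∈ alternatingLift e τ b i ↔ ∃ j, AlternatingIndex e i j ∧ ∃ y ∈ b j, y + τ i = x := by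
  unfold alternatingLift AlternatingIndex
  rw [mem_shift]
  split_ifs
  · simp only [List.mem_reverse, List.mem_append]
    constructor
    · rintro ⟨y, h | h | h, rfl⟩
      exacts [⟨_, Or.inl rfl, y, h, rfl⟩, ⟨_, Or.inr (Or.inl rfl), y, h, rfl⟩,
        ⟨_, Or.inr (Or.inr rfl), y, h, rfl⟩]
    · rintro ⟨j, rfl | rfl | rfl, y, h, rfl⟩
      exacts [⟨y, Or.inl h, rfl⟩, ⟨y, Or.inr (Or.inl h), rfl⟩, ⟨y, Or.inr (Or.inr h), rfl⟩]
  · simp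

lemma nodup_append_of_sections {F' : Fin 8 → Set Square}
    (hF' : ∀ i j x, x ∈ F' i → x ∈ F' j → i = j) {j : Fin 8} {k l : List Square}
    (hk : k.Nodup) (hl : l.Nodup) (hkj : ∀ x ∈ k, x ∈ F' j)
    (hlj : ∀ x ∈ l, ∃ i, i ≠ j ∧ x ∈ F' i) : (k ++ l).Nodup := by
  refine hk.append hl fun x hx hx' => ?_
  obtain ⟨i, hi, h⟩ := hlj x hx'
  exact hi (hF' _ _ _ h (hkj x hx))

/-- Applying `c i` to two consecutive lifted lists, one short and one of three pieces, moves one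
piece by `h5` or `h4` onto a copy of itself and two others, by `he0` or `he1`, through a crossing of
the smaller frame. The property `cross` of `b` then turns these two into the missing pieces of the
opposite lists. -/
theorem ProperSystem.alternatingLift {F F' : Fin 8 → Set Square} {c c' τ : Fin 8 → Square}
    {R : Square → Square → Prop} {b : Fin 8 → List Square} (hb : ProperSystem F' c' R b)
    (hRs : ∀ x y, R x y → R y x) (hRt : ∀ x y t, R x y → R (x + t) (y + t))
    (e : Fin 8 → Bool) (he : ∀ i, e (i + 1) = !e i)
    (hJ : ∀ i j, AlternatingIndex e i j → ∀ y ∈ F' j, y + τ i ∈ F i)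
    (h5 : ∀ i, τ i + c i = τ (i + 5)) (h4 : ∀ i, τ (i + 1) + c i = τ (i + 4))
    (he1 : ∀ i, e i = true → τ i + c i = c' (i + 3) + τ (i + 4))
    (he0 : ∀ i, e i = false → τ (i + 1) + c i = c' (i + 5) + τ (i + 5))
    (hdisj : ∀ j, ∀ y ∈ F' j ∪ F' (j + 1), y + c' j ∈ F' (j + 4) ∪ F' (j + 5))
    (hF' : ∀ i j x, x ∈ F' i → x ∈ F' j → i = j) :
    ProperSystem F c R (alternatingLift e τ b) := by
  have e2 : ∀ i, e (i + 2) = e i := fun i => by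
    rw [show i + 2 = i + 1 + 1 by rw [add_assoc]; rfl, he, he, Bool.not_not]
  have e3 : ∀ i, e (i + 3) = !e i := fun i => by
    rw [show i + 3 = i + 2 + 1 by rw [add_assoc]; rfl, he, e2]
  have e4 : ∀ i, e (i + 4) = e i := fun i => by
    rw [show i + 4 = i + 2 + 2 by rw [add_assoc]; rfl, e2, e2]
  have e5 : ∀ i, e (i + 5) = !e i := fun i => by
    rw [show i + 5 = i + 4 + 1 by rw [add_assoc]; rfl, he, e4]
  have cross : ∀ i, shift (c i) (_root_.alternatingLift e τ b i ++
      _root_.alternatingLift e τ b (i + 1)) =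
      (_root_.alternatingLift e τ b (i + 5)).reverse ++
        (_root_.alternatingLift e τ b (i + 4)).reverse := by
    intro i
    unfold _root_.alternatingLift
    rw [he, e4, e5]
    cases h : e i
    · have := hb.cross_reverse (i + 5)
      simp only [Bool.not_false, if_true, if_false, Bool.false_eq_true, shift_append,
        List.reverse_append, shift_reverse, List.reverse_reverse, shift_shift, h5, h4, add_assoc,
        Fin.isValue, Fin.reduceAdd, add_zero, List.append_assoc] at this ⊢
      have h' := congrArg (shift (τ (i + 5))) this
      simp only [shift_append, shift_reverse, shift_shift] at h'
      have h0 := he0 i h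
      rw [h4] at h0
      rw [h0]
      rw [← List.append_assoc (shift (τ (i+5)) (b (i + 1))), h']
      simp
    · have := hb.cross_reverse (i + 3)
      simp only [Bool.not_true, if_true, if_false, Bool.false_eq_true, shift_append,
        List.reverse_append, shift_reverse, List.reverse_reverse, shift_shift, h5, h4, add_assoc,
        Fin.isValue, Fin.reduceAdd, add_zero, List.append_assoc] at this ⊢
      have h' := congrArg (shift (τ (i + 4))) this
      simp only [shift_append, shift_reverse, shift_shift] at h'
      have h0 := he1 i h
      rw [h5] at h0
      rw [← List.append_assoc (shift (τ (i+4)) (b (i + 7))), h', h0]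
      simp
  have chain3 : ∀ i, (b i ++ (b (i + 1) ++ b (i + 2))).IsChain R := fun i => by
    have := hb.chain (i + 1)
    rw [show i + 1 + 1 = i + 2 by rw [add_assoc]; rfl] at this
    exact isChain_glue (hb.ne_nil _) (hb.chain i) this
  refine ⟨?_, ?_, ?_, cross, ?_, ?_⟩
  · intro i
    refine shift_ne_nil ?_
    split_ifs
    · simp [hb.ne_nil]
    · exact hb.ne_nil i
  · intro i x hx
    obtain ⟨j, hj, y, hy, rfl⟩ := mem_alternatingLift.1 hx
    exact hJ i j hj y (hb.mem j y hy)
  · intro i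
    refine nodup_shift ?_
    split_ifs
    · refine List.nodup_reverse.2 (nodup_append_of_sections hF' (hb.nodup _)
        (nodup_append_of_sections hF' (hb.nodup _) (hb.nodup _) (hb.mem _) ?_) (hb.mem _) ?_)
      · exact fun x hx => ⟨i + 5, by simp, hb.mem _ x hx⟩
      · intro x hx
        rcases List.mem_append.1 hx with hx | hx
        exacts [⟨i + 4, by simp, hb.mem _ x hx⟩, ⟨i + 5, by simp, hb.mem _ x hx⟩]
    · exact hb.nodup i
  · intro i
    unfold _root_.alternatingLift
    rw [he]
    cases h : e i
    · simp only [Bool.not_false, if_true, if_false, Bool.false_eq_true,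
        List.reverse_append, add_assoc, Fin.isValue, Fin.reduceAdd, List.append_assoc]
      rw [shift_append _ (b (i + 6)).reverse, shift_append _ (b (i + 5)).reverse,
        ← List.append_assoc (shift (τ (i + 1)) (b (i + 6)).reverse), ← shift_append]
      refine isChain_glue (shift_ne_nil (by simp [hb.ne_nil])) ?_ ?_
      · have := hb.cross_reverse (i + 5)
        simp only [add_assoc, Fin.isValue, Fin.reduceAdd] at this
        -- The junction of two lifted lists straddles two different translates, but the crossing `c
        -- i` brings it into a single translate of three consecutive lists of `b`, where the chain
        -- property is known.
        have key : shift (c i) (shift (τ i) (b i) ++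
            shift (τ (i + 1)) ((b (i + 6)).reverse ++ (b (i + 5)).reverse)) =
            shift (τ (i + 5)) (b i ++ (b (i + 1) ++ b (i + 2))) := by
          rw [this, shift_append, shift_append _ (b i), shift_shift, shift_shift, shift_shift, h5,
            he0 i h]
        have := isChain_shift hRt (t := -c i) (key ▸ isChain_shift hRt (chain3 i))
        simpa [shift_shift, shift] using this
      · rw [← shift_append, List.append_assoc]
        have := isChain_shift hRt (t := τ (i + 1)) (isChain_reverse_of_symm hRs (chain3 (i + 4)))
        simpa [add_assoc] using this
    · simp only [Bool.not_true, if_true, if_false, Bool.false_eq_true,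
        List.reverse_append, add_assoc, Fin.isValue, Fin.reduceAdd, List.append_assoc]
      rw [shift_append _ (b (i + 5)).reverse, List.append_assoc]
      refine isChain_glue (shift_ne_nil (by simp [hb.ne_nil])) ?_ ?_
      · rw [← shift_append]
        have := isChain_shift hRt (t := τ i) (isChain_reverse_of_symm hRs (chain3 (i + 3)))
        simpa [add_assoc] using this
      · have := hb.cross_reverse (i + 3)
        simp only [add_assoc, Fin.isValue, Fin.reduceAdd, add_zero] at this
        have key : shift (c i) (shift (τ i) ((b (i + 4)).reverse ++ (b (i + 3)).reverse) ++
            shift (τ (i + 1)) (b (i + 1))) =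
            shift (τ (i + 4)) (b (i + 7) ++ (b i ++ b (i + 1))) := by
          rw [← List.append_assoc, this, shift_append, shift_append _ (shift _ _),
            shift_shift, shift_shift, shift_shift, h4, he1 i h]
        have c3 := chain3 (i + 7)
        simp only [add_assoc, Fin.isValue, Fin.reduceAdd, add_zero] at c3
        have := isChain_shift hRt (t := -c i) (key ▸ isChain_shift hRt c3)
        simpa [shift_shift, shift] using this
  · intro T hT ⟨i, x, hx, h⟩
    obtain ⟨j, hj, y, hy, rfl⟩ := mem_alternatingLift.1 hx
    have := hb.orbit_lift (AlternatingIndex e) hJ h5 h4 ?_ ?_ hdisj hF' T hT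
      ⟨i, j, hj, y, hy, h⟩
    · intro i x hx
      obtain ⟨j, hj, y, hy, rfl⟩ := mem_alternatingLift.1 hx
      exact this i j hj y hy
    · intro j S hS5 hS4
      have hS4' : ∀ i, AlternatingIndex e i j → S i → S (i + 3) := by
        intro i hi h
        have := hS4 (i + 7)
        simp only [add_assoc, Fin.isValue, Fin.reduceAdd, add_zero] at this
        exact this hi h
      -- If `e j` is false, the copies of the section `j` lie in the sections `j`, `j + 3`, `j + 5`,
      -- and the one in `j` is linked to both others. If `e j` is true, there is only the copy in `j
      -- + 4`.
      cases hj : e j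
      · have hjj : AlternatingIndex e j j := by simp [AlternatingIndex, hj]
        have h3 : AlternatingIndex e (j + 3) j := by
          simp [AlternatingIndex, e3, hj, add_assoc]
        have h5 : AlternatingIndex e (j + 5) j := by
          simp [AlternatingIndex, e5, hj, add_assoc]
        have cases_of : ∀ i, AlternatingIndex e i j → i = j ∨ i = j + 3 ∨ i = j + 5 := by
          intro i hi
          unfold AlternatingIndex at hi
          split_ifs at hi with hei
          · rcases hi with rfl | rfl | rfl
            · simp [add_assoc]
            · rw [e4, hei] at hj
              exact absurd hj (by simp)
            · simp [add_assoc]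
          · exact Or.inl hi.symm
        have hub : (∃ i, AlternatingIndex e i j ∧ S i) → S j := by
          rintro ⟨i, hi, h⟩
          rcases cases_of i hi with rfl | rfl | rfl
          · exact h
          · simpa [add_assoc] using hS5 _ h3 h
          · simpa [add_assoc] using hS4' _ h5 h
        intro hex i hi
        rcases cases_of i hi with rfl | rfl | rfl
        · exact hub hex
        · exact hS4' _ hjj (hub hex)
        · exact hS5 _ hjj (hub hex)
      · have uniq : ∀ i, AlternatingIndex e i j → i = j + 4 := by
          intro i hi
          unfold AlternatingIndex at hi
          split_ifs at hi with hei
          · rcases hi with rfl | rfl | rfl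
            · rw [e3, hei] at hj
              exact absurd hj (by simp)
            · simp [add_assoc]
            · rw [e5, hei] at hj
              exact absurd hj (by simp)
          · exact absurd (hi ▸ hj) hei
        rintro ⟨i, hi, h⟩ i' hi'
        rwa [uniq i' hi', ← uniq i hi]
    · intro j
      cases hj : e j
      · refine ⟨j + 5, j + 5, j + 1, ?_, ?_, ?_, ?_, Or.inl rfl, ?_⟩
        iterate 4 simp [AlternatingIndex, e5, he, hj, add_assoc]
        simpa [add_assoc] using he1 (j + 5) (by rw [e5, hj]; rfl)
      · refine ⟨j + 4, j + 3, j, ?_, ?_, ?_, ?_, Or.inr (by rw [add_assoc]; rfl), ?_⟩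
        iterate 4 simp [AlternatingIndex, e4, hj, add_assoc]
        simpa [add_assoc] using he0 (j + 3) (by rw [e3, hj]; rfl)

/-! ### The wide lift. -/

/-- The lists that make up the wide lift of a proper system `b`: three consecutive lists where
`e i` is false and five consecutive lists, reversed, where `e i` is true. -/
def wideLift (e : Fin 8 → Bool) (τ : Fin 8 → Square) (b : Fin 8 → List Square) (i : Fin 8) :
    List Square :=
  shift (τ i) (if e i then
    (b (i + 2) ++ (b (i + 3) ++ (b (i + 4) ++ (b (i + 5) ++ b (i + 6))))).reverse
    else b (i + 7) ++ (b i ++ b (i + 1)))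

/-- The section `i` receives a translate of the section `j` in a wide lift. -/
def WideIndex (e : Fin 8 → Bool) (i j : Fin 8) : Prop :=
  if e i then j = i + 2 ∨ j = i + 3 ∨ j = i + 4 ∨ j = i + 5 ∨ j = i + 6
  else j = i + 7 ∨ j = i ∨ j = i + 1

lemma mem_wideLift {e τ b i x} :
    x ∈ wideLift e τ b i ↔ ∃ j, WideIndex e i j ∧ ∃ y ∈ b j, y + τ i = x := by
  unfold wideLift WideIndex
  rw [mem_shift]
  split_ifs
  · simp only [List.mem_reverse, List.mem_append]
    constructor
    · rintro ⟨y, h | h | h | h | h, rfl⟩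
      exacts [⟨_, Or.inl rfl, y, h, rfl⟩, ⟨_, Or.inr (Or.inl rfl), y, h, rfl⟩,
        ⟨_, Or.inr (Or.inr (Or.inl rfl)), y, h, rfl⟩,
        ⟨_, Or.inr (Or.inr (Or.inr (Or.inl rfl))), y, h, rfl⟩,
        ⟨_, Or.inr (Or.inr (Or.inr (Or.inr rfl))), y, h, rfl⟩]
    · rintro ⟨j, rfl | rfl | rfl | rfl | rfl, y, h, rfl⟩ <;> exact ⟨y, by simp [h], rfl⟩
  · simp only [List.mem_append]
    constructor
    · rintro ⟨y, h | h | h, rfl⟩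
      exacts [⟨_, Or.inl rfl, y, h, rfl⟩, ⟨_, Or.inr (Or.inl rfl), y, h, rfl⟩,
        ⟨_, Or.inr (Or.inr rfl), y, h, rfl⟩]
    · rintro ⟨j, rfl | rfl | rfl, y, h, rfl⟩ <;> exact ⟨y, by simp [h], rfl⟩

lemma WideIndex.eq_add {e : Fin 8 → Bool} {i j : Fin 8} (h : WideIndex e i j) :
    (e i = true ∧ (i = j + 6 ∨ i = j + 5 ∨ i = j + 4 ∨ i = j + 3 ∨ i = j + 2)) ∨
      (e i = false ∧ (i = j + 1 ∨ i = j ∨ i = j + 7)) := by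
  unfold WideIndex at h
  split_ifs at h with he
  · refine Or.inl ⟨he, ?_⟩
    clear he
    revert i j
    decide
  · refine Or.inr ⟨by simpa using he, ?_⟩
    clear he
    revert i j
    decide

/-- The mechanism is that of the alternating lift, with lists of three and five pieces: of the
pieces moved by `c i`, exactly two use a crossing of the smaller frame. -/
theorem ProperSystem.wideLift {F F' : Fin 8 → Set Square} {c c' τ : Fin 8 → Square}
    {R : Square → Square → Prop} {b : Fin 8 → List Square} (hb : ProperSystem F' c' R b)
    (hRs : ∀ x y, R x y → R y x) (hRt : ∀ x y t, R x y → R (x + t) (y + t))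
    (e : Fin 8 → Bool) (he : ∀ i, e (i + 1) = !e i)
    (hJ : ∀ i j, WideIndex e i j → ∀ y ∈ F' j, y + τ i ∈ F i)
    (h5 : ∀ i, τ i + c i = τ (i + 5)) (h4 : ∀ i, τ (i + 1) + c i = τ (i + 4))
    (he1 : ∀ i, e i = true → τ i + c i = c' (i + 2) + τ (i + 4))
    (he0 : ∀ i, e i = false → τ (i + 1) + c i = c' (i + 6) + τ (i + 5))
    (hdisj : ∀ j, ∀ y ∈ F' j ∪ F' (j + 1), y + c' j ∈ F' (j + 4) ∪ F' (j + 5))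
    (hF' : ∀ i j x, x ∈ F' i → x ∈ F' j → i = j) :
    ProperSystem F c R (wideLift e τ b) := by
  have e2 : ∀ i, e (i + 2) = e i := fun i => by
    rw [show i + 2 = i + 1 + 1 by rw [add_assoc]; rfl, he, he, Bool.not_not]
  have e3 : ∀ i, e (i + 3) = !e i := fun i => by
    rw [show i + 3 = i + 2 + 1 by rw [add_assoc]; rfl, he, e2]
  have e4 : ∀ i, e (i + 4) = e i := fun i => by
    rw [show i + 4 = i + 2 + 2 by rw [add_assoc]; rfl, e2, e2]
  have e5 : ∀ i, e (i + 5) = !e i := fun i => by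
    rw [show i + 5 = i + 4 + 1 by rw [add_assoc]; rfl, he, e4]
  have e6 : ∀ i, e (i + 6) = e i := fun i => by
    rw [show i + 6 = i + 4 + 2 by rw [add_assoc]; rfl, e2, e4]
  have e7 : ∀ i, e (i + 7) = !e i := fun i => by
    rw [show i + 7 = i + 6 + 1 by rw [add_assoc]; rfl, he, e6]
  have cross : ∀ i, shift (c i) (_root_.wideLift e τ b i ++ _root_.wideLift e τ b (i + 1)) =
      (_root_.wideLift e τ b (i + 5)).reverse ++ (_root_.wideLift e τ b (i + 4)).reverse := by
    intro i
    unfold _root_.wideLift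
    rw [he, e4, e5]
    cases h : e i
    · have := hb.cross_reverse (i + 6)
      simp only [Bool.not_false, if_true, if_false, Bool.false_eq_true, shift_append,
        List.reverse_append, shift_reverse, List.reverse_reverse, shift_shift, h5, h4, add_assoc,
        Fin.isValue, Fin.reduceAdd, add_zero, List.append_assoc] at this ⊢
      have h' := congrArg (shift (τ (i + 5))) this
      simp only [shift_append, shift_reverse, shift_shift] at h'
      have h0 := he0 i h
      rw [h4] at h0
      rw [h0, ← List.append_assoc (shift (τ (i+5)) (b (i + 2))), h']
      simp
    · have := hb.cross_reverse (i + 2)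
      simp only [Bool.not_true, if_true, if_false, Bool.false_eq_true, shift_append,
        List.reverse_append, shift_reverse, List.reverse_reverse, shift_shift, h5, h4, add_assoc,
        Fin.isValue, Fin.reduceAdd, add_zero, List.append_assoc] at this ⊢
      have h' := congrArg (shift (τ (i + 4))) this
      simp only [shift_append, shift_reverse, shift_shift] at h'
      have h0 := he1 i h
      rw [h5] at h0
      rw [← List.append_assoc (shift (τ (i+4)) (b (i + 6))), h', h0]
      simp
  have chain5 : ∀ i, (b i ++ (b (i + 1) ++ (b (i + 2) ++ (b (i + 3) ++ b (i + 4))))).IsChain R := by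
    intro i
    have h1 := hb.chain (i + 1)
    have h2 := hb.chain (i + 2)
    have h3 := hb.chain (i + 3)
    simp only [add_assoc, Fin.isValue, Fin.reduceAdd] at h1 h2 h3
    exact isChain_glue (hb.ne_nil _) (hb.chain i) (isChain_glue (hb.ne_nil _) h1
      (isChain_glue (hb.ne_nil _) h2 h3))
  refine ⟨?_, ?_, ?_, cross, ?_, ?_⟩
  · intro i
    refine shift_ne_nil ?_
    split_ifs <;> simp [hb.ne_nil]
  · intro i x hx
    obtain ⟨j, hj, y, hy, rfl⟩ := mem_wideLift.1 hx
    exact hJ i j hj y (hb.mem j y hy)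
  · intro i
    have step : ∀ (j : Fin 8) (s : List (Fin 8)), j ∉ s → (s.flatMap b).Nodup →
        (b j ++ s.flatMap b).Nodup := fun j s hj hs =>
      nodup_append_of_sections hF' (hb.nodup j) hs (hb.mem j) fun x hx =>
        let ⟨i, hi, hx⟩ := List.mem_flatMap.1 hx
        ⟨i, fun h => hj (h ▸ hi), hb.mem i x hx⟩
    have flat : ∀ s : List (Fin 8), s.Nodup → (s.flatMap b).Nodup := by
      intro s
      induction s with
      | nil => simp
      | cons j s ih =>
        intro h
        rw [List.flatMap_cons]
        exact step j s (List.nodup_cons.1 h).1 (ih (List.nodup_cons.1 h).2)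
    refine nodup_shift ?_
    split_ifs
    · refine List.nodup_reverse.2 ?_
      simpa using flat [i + 2, i + 3, i + 4, i + 5, i + 6] (by simp)
    · simpa using flat [i + 7, i, i + 1] (by simp)
  · intro i
    unfold _root_.wideLift
    rw [he]
    cases h : e i
    · simp only [Bool.not_false, if_true, if_false, Bool.false_eq_true,
        List.reverse_append, add_assoc, Fin.isValue, Fin.reduceAdd, List.append_assoc]
      rw [← List.append_assoc (b (i + 7)).reverse, shift_append _ (_ ++ _)]
      refine isChain_glue (shift_ne_nil (by simp [hb.ne_nil])) ?_ ?_
      · have := hb.cross_reverse (i + 6)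
        simp only [add_assoc, Fin.isValue, Fin.reduceAdd] at this
        have key : shift (c i) (shift (τ i) (b (i + 7) ++ (b i ++ b (i + 1))) ++
            shift (τ (i + 1)) ((b (i + 7)).reverse ++ (b (i + 6)).reverse)) =
            shift (τ (i + 5)) (b (i + 7) ++ (b i ++ (b (i + 1) ++ (b (i + 2) ++ b (i + 3))))) := by
          rw [this, shift_append, shift_shift, shift_shift, h5, he0 i h, ← shift_shift (τ (i + 5)),
            ← shift_append]
          simp
        have c5 := chain5 (i + 7)
        simp only [add_assoc, Fin.isValue, Fin.reduceAdd, add_zero] at c5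
        have := isChain_shift hRt (t := -c i) (key ▸ isChain_shift hRt c5)
        simpa [shift_shift, shift] using this
      · rw [← shift_append, List.append_assoc]
        have := isChain_shift hRt (t := τ (i + 1)) (isChain_reverse_of_symm hRs (chain5 (i + 3)))
        simpa [add_assoc] using this
    · simp only [Bool.not_true, if_true, if_false, Bool.false_eq_true,
        List.reverse_append, add_assoc, Fin.isValue, Fin.reduceAdd, List.append_assoc]
      rw [← List.append_assoc (b (i + 5)).reverse, ← List.append_assoc (b (i + 6)).reverse,
        shift_append _ (_ ++ _), List.append_assoc]
      refine isChain_glue (shift_ne_nil (by simp [hb.ne_nil])) ?_ ?_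
      · rw [← shift_append]
        have := isChain_shift hRt (t := τ i) (isChain_reverse_of_symm hRs (chain5 (i + 2)))
        simpa [add_assoc] using this
      · have := hb.cross_reverse (i + 2)
        simp only [add_assoc, Fin.isValue, Fin.reduceAdd] at this
        have key : shift (c i) (shift (τ i) ((b (i + 3)).reverse ++ (b (i + 2)).reverse) ++
            shift (τ (i + 1)) (b i ++ (b (i + 1) ++ b (i + 2)))) =
            shift (τ (i + 4)) (b (i + 6) ++ (b (i + 7) ++ (b i ++ (b (i + 1) ++ b (i + 2))))) := by
          rw [← List.append_assoc (b (i + 6)), this, shift_append, shift_append _ (shift _ _),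
            shift_shift, shift_shift, shift_shift, h4, he1 i h]
        have c5 := chain5 (i + 6)
        simp only [add_assoc, Fin.isValue, Fin.reduceAdd, add_zero] at c5
        have := isChain_shift hRt (t := -c i) (key ▸ isChain_shift hRt c5)
        have h8 : i + 8 = i := add_zero i
        simpa [shift_shift, shift] using this
  · intro T hT ⟨i, x, hx, h⟩
    obtain ⟨j, hj, y, hy, rfl⟩ := mem_wideLift.1 hx
    have := hb.orbit_lift (WideIndex e) hJ h5 h4 ?_ ?_ hdisj hF' T hT
      ⟨i, j, hj, y, hy, h⟩
    · intro i x hx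
      obtain ⟨j, hj, y, hy, rfl⟩ := mem_wideLift.1 hx
      exact this i j hj y hy
    · intro j S hS5 hS4
      have hS4' : ∀ i, WideIndex e i j → S i → S (i + 3) := by
        intro i hi h
        have := hS4 (i + 7)
        simp only [add_assoc, Fin.isValue, Fin.reduceAdd, add_zero] at this
        exact this hi h
      have link : ∀ i, WideIndex e i j → WideIndex e (i + 5) j → (S i ↔ S (i + 5)) := by
        intro i h h'
        exact ⟨hS5 i h, fun hs => by simpa [add_assoc] using hS4' _ h' hs⟩
      cases hj : e j
      · have j0 : WideIndex e j j := by simp [WideIndex, hj]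
        have j3 : WideIndex e (j + 3) j := by simp [WideIndex, e3, hj, add_assoc]
        have j5 : WideIndex e (j + 5) j := by simp [WideIndex, e5, hj, add_assoc]
        have l0 := link j j0 j5
        have l3 := link (j + 3) j3 (by simpa [add_assoc] using j0)
        simp only [add_assoc, Fin.isValue, Fin.reduceAdd, add_zero] at l3
        have cases_of : ∀ i, WideIndex e i j → (S i ↔ S j) := by
          intro i hi
          have : i = j ∨ i = j + 3 ∨ i = j + 5 := by
            rcases hi.eq_add with ⟨h, rfl | rfl | rfl | rfl | rfl⟩ | ⟨h, rfl | rfl | rfl⟩ <;>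
              simp [he, e2, e3, e4, e5, e6, e7, hj] at h ⊢
          rcases this with rfl | rfl | rfl
          exacts [Iff.rfl, l3, l0.symm]
        rintro ⟨i, hi, h⟩ i' hi'
        exact (cases_of i' hi').2 ((cases_of i hi).1 h)
      · have j1 : WideIndex e (j + 1) j := by simp [WideIndex, he, hj, add_assoc]
        have j2 : WideIndex e (j + 2) j := by simp [WideIndex, e2, hj, add_assoc]
        have j4 : WideIndex e (j + 4) j := by simp [WideIndex, e4, hj, add_assoc]
        have j6 : WideIndex e (j + 6) j := by simp [WideIndex, e6, hj, add_assoc]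
        have j7 : WideIndex e (j + 7) j := by simp [WideIndex, e7, hj, add_assoc]
        -- The five copies of the section `j` are linked by steps of 5 along the path `j + 2`, `j +
        -- 7`, `j + 4`, `j + 1`, `j + 6`.
        have l2 := link (j + 2) j2 (by simpa [add_assoc] using j7)
        have l7 := link (j + 7) j7 (by simpa [add_assoc] using j4)
        have l4 := link (j + 4) j4 (by simpa [add_assoc] using j1)
        have l1 := link (j + 1) j1 (by simpa [add_assoc] using j6)
        simp only [add_assoc, Fin.isValue, Fin.reduceAdd] at l2 l7 l4 l1
        have cases_of : ∀ i, WideIndex e i j → (S i ↔ S (j + 4)) := by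
          intro i hi
          have : i = j + 1 ∨ i = j + 2 ∨ i = j + 4 ∨ i = j + 6 ∨ i = j + 7 := by
            rcases hi.eq_add with ⟨h, rfl | rfl | rfl | rfl | rfl⟩ | ⟨h, rfl | rfl | rfl⟩ <;>
              simp [he, e2, e3, e4, e5, e6, e7, hj] at h ⊢
          rcases this with rfl | rfl | rfl | rfl | rfl
          exacts [l4.symm, l2.trans l7, Iff.rfl, l1.symm.trans l4.symm, l7]
        rintro ⟨i, hi, h⟩ i' hi'
        exact (cases_of i' hi').2 ((cases_of i hi).1 h)
    · intro j
      cases hj : e j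
      · refine ⟨j + 3, j + 2, j + 7, ?_, ?_, ?_, ?_, Or.inr (by rw [add_assoc]; rfl), ?_⟩
        iterate 4 simp [WideIndex, e3, e7, hj, add_assoc]
        simpa [add_assoc] using he0 (j + 2) (by rw [e2, hj])
      · refine ⟨j + 6, j + 6, j + 2, ?_, ?_, ?_, ?_, Or.inl rfl, ?_⟩
        iterate 4 simp [WideIndex, e2, e6, hj, add_assoc]
        simpa [add_assoc] using he1 (j + 6) (by rw [e6, hj])

/-! ### Octagons and the dissection of a frame into copies of smaller sections. -/

/-- The vertices of a cycle of length eight of the `(m, n)`-leaper, relative to the southwest one,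
numbered by the directions of the sections that they belong to. -/
def octagon (m n : ℤ) : Fin 8 → Square :=
  ![(n, m), (2 * m, 2 * m), (m, n), (0, 2 * m), (2 * m - n, m), (0, 0), (m, 2 * m - n), (2 * m, 0)]

/-- Crossings permute the vertices of an octagon by steps of 5. The same identities show that
crossings permute the copies made by the translations `octagon i`. -/
lemma octagon_add_crossing (m n : ℕ) (i : Fin 8) :
    octagon m n i + crossing m n i = octagon m n (i + 5) := by
  fin_cases i <;> simp [octagon, crossing, Prod.ext_iff] <;> omega

lemma octagon_succ_add_crossing (m n : ℕ) (i : Fin 8) :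
    octagon m n (i + 1) + crossing m n i = octagon m n (i + 4) := by
  fin_cases i <;> simp [octagon, crossing, Prod.ext_iff] <;> omega

lemma frameSection_disjoint {o : Square} {m n : ℕ} (hmn : m ≤ n) (i j : Fin 8) (x : Square)
    (hi : x ∈ frameSection o m n i) (hj : x ∈ frameSection o m n j) : i = j := by
  have third_inj : ∀ t d e : ℤ, t ∈ third m n d → t ∈ third m n e →
      (d < 0 ↔ e < 0) ∧ (d = 0 ↔ e = 0) := by
    intro t d e hd he
    unfold third at hd he
    split_ifs at hd he <;> simp only [Set.mem_Ico] at hd he <;> omega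
  have h1 := third_inj _ _ _ hi.1 hj.1
  have h2 := third_inj _ _ _ hi.2 hj.2
  clear hi hj third_inj
  revert i j
  decide

lemma crossing_mem {o : Square} {m n : ℕ} (hmn : m ≤ n) (j : Fin 8) (y : Square)
    (hy : y ∈ frameSection o m n j ∪ frameSection o m n (j + 1)) :
    y + crossing m n j ∈ frameSection o m n (j + 4) ∪ frameSection o m n (j + 5) := by
  fin_cases j <;> simp [frameSection, third, dir, crossing] at hy ⊢ <;> omega

lemma isMove_symm (M : Leaper) (x y : Square) (h : M.IsMove x y) : M.IsMove y x := by
  unfold Leaper.IsMove at h ⊢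
  rwa [abs_sub_comm x.1, abs_sub_comm x.2]

lemma isMove_add (M : Leaper) (x y t : Square) (h : M.IsMove x y) : M.IsMove (x + t) (y + t) := by
  simpa [Leaper.IsMove] using h

def evenIndex (i : Fin 8) : Bool := i.val % 2 = 0

def oddIndex (i : Fin 8) : Bool := i.val % 2 = 1

/-- The eight squares of a cycle of length eight form a proper system. -/
theorem properSystem_octagon {o z : Square} {m n : ℕ} {M : Leaper}
    (hp : (M.p : ℤ) = |2 * (m : ℤ) - n|) (hq : M.q = m)
    (hz : ∀ i, z + octagon m n i ∈ frameSection o m n i) :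
    ProperSystem (frameSection o m n) (crossing m n) M.IsMove fun i => [z + octagon m n i] := by
  refine ⟨by simp, by simpa using hz, by simp, ?_, ?_, ?_⟩
  · intro i
    simp [shift, add_assoc, octagon_add_crossing, octagon_succ_add_crossing]
  · intro i
    have hm : |(m : ℤ)| = m := Nat.abs_cast m
    rw [List.singleton_append, List.isChain_pair]
    unfold Leaper.IsMove
    rw [hp, hq, ← hm, abs_eq_abs, abs_eq_abs, abs_eq_abs, abs_eq_abs]
    fin_cases i <;> simp [octagon] <;> omega
  · rintro T hT ⟨i, x, hx, h⟩
    have step : ∀ i, T (z + octagon m n i) → T (z + octagon m n (i + 5)) := by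
      intro i h
      have := hT i _ (Or.inl (hz i)) h
      rwa [add_assoc, octagon_add_crossing] at this
    have hi : T (z + octagon m n i) := by simpa [List.mem_singleton.1 hx] using h
    have succ : ∀ i, T (z + octagon m n i) → T (z + octagon m n (i + 1)) := by
      intro i h
      -- Five steps of 5 amount to 25, which is 1 modulo 8.
      simpa [add_assoc] using step _ (step _ (step _ (step _ (step _ h))))
    have all : ∀ k, T (z + octagon m n (i + k)) := by
      have h0 : T (z + octagon m n (i + 0)) := by rwa [add_zero]
      have next : ∀ k, T (z + octagon m n (i + k)) → T (z + octagon m n (i + (k + 1))) := by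
        intro k h
        rw [← add_assoc i]
        exact succ _ h
      intro k
      induction k using Fin.induction with
      | zero => exact h0
      | succ k ih =>
        rw [← Fin.coeSucc_eq_succ]
        exact next _ ih
    intro j y hy
    rw [List.mem_singleton.1 hy]
    simpa using all (j - i)

/-- Used for `m < d`. No octagon fits in the frame then, so none has to be excluded. -/
lemma exists_index_of_long {o x : Square} {m d : ℕ} (k : Fin 8)
    (hx : x ∈ frameSection o m (2 * m + d) k) :
    ∃ j, AlternatingIndex evenIndex k j ∧
      x - octagon m (2 * m + d : ℕ) k ∈ frameSection o m d j := by
  simp only [AlternatingIndex]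
  fin_cases k <;> simp [evenIndex, frameSection, third, dir, octagon] at hx ⊢ <;> omega

lemma mem_of_index_of_long {o : Square} {m d : ℕ} (i j : Fin 8)
    (h : AlternatingIndex evenIndex i j) (y : Square) (hy : y ∈ frameSection o m d j) :
    y + octagon m (2 * m + d : ℕ) i ∈ frameSection o m (2 * m + d) i := by
  fin_cases i <;> fin_cases j <;> simp [AlternatingIndex, evenIndex] at h <;>
    simp [frameSection, third, dir, octagon] at hy ⊢ <;> omega

/-- Subtracting `octagon k` sends `F k` into the board of the smaller frame. The octagons are the
copies of the squares of its hole, so outside them the image lies in a section. -/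
lemma exists_index_of_wide {o x : Square} {m d : ℕ} (k : Fin 8)
    (hx : x ∈ frameSection o m (2 * m + d) k)
    (hz : ¬ ∀ i, x - octagon m (2 * m + d : ℕ) k + octagon m (2 * m + d : ℕ) i ∈
      frameSection o m (2 * m + d) i) :
    ∃ j, WideIndex evenIndex k j ∧
      x - octagon m (2 * m + d : ℕ) k ∈ frameSection o d m j := by
  have hz' : ¬ ((d ≤ (x - octagon m (2 * m + d : ℕ) k).1 - o.1 ∧
      (x - octagon m (2 * m + d : ℕ) k).1 - o.1 < m) ∧
      d ≤ (x - octagon m (2 * m + d : ℕ) k).2 - o.2 ∧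
      (x - octagon m (2 * m + d : ℕ) k).2 - o.2 < m) := by
    contrapose! hz
    generalize x - octagon m (2 * m + d : ℕ) k = z at hz
    intro i
    fin_cases i <;> simp [frameSection, third, dir, octagon] <;> omega
  clear hz
  simp only [WideIndex]
  fin_cases k <;> simp [evenIndex, frameSection, third, dir, octagon] at hx hz' ⊢ <;> omega

lemma mem_of_index_of_wide {o : Square} {m d : ℕ} (hd : d < m) (i j : Fin 8)
    (h : WideIndex evenIndex i j) (y : Square) (hy : y ∈ frameSection o d m j) :
    y + octagon m (2 * m + d : ℕ) i ∈ frameSection o m (2 * m + d) i := by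
  fin_cases i <;> fin_cases j <;> simp [WideIndex, evenIndex] at h <;>
    simp [frameSection, third, dir, octagon] at hy ⊢ <;> omega

/-- Here `2 * m - n = d` is nonnegative, and subtracting `octagon k` can give coordinates as low as
`-d` relative to `o`; hence the smaller frame starts at `o - (d, d)`. Its hole again accounts for
the octagons. -/
lemma exists_index_of_short {o x : Square} {m n d : ℕ} (hn : n + d = 2 * m) (k : Fin 8)
    (hx : x ∈ frameSection o m n k)
    (hz : ¬ ∀ i, x - octagon m n k + octagon m n i ∈ frameSection o m n i) :
    ∃ j, AlternatingIndex oddIndex k j ∧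
      x - octagon m n k ∈ frameSection (o - ((d : ℤ), (d : ℤ))) d m j := by
  have hz' : ¬ ((0 ≤ (x - octagon m n k).1 - o.1 ∧ (x - octagon m n k).1 - o.1 < m - d) ∧
      0 ≤ (x - octagon m n k).2 - o.2 ∧ (x - octagon m n k).2 - o.2 < m - d) := by
    contrapose! hz
    generalize x - octagon m n k = z at hz
    intro i
    fin_cases i <;> simp [frameSection, third, dir, octagon] <;> omega
  clear hz
  simp only [AlternatingIndex]
  fin_cases k <;> simp [oddIndex, frameSection, third, dir, octagon] at hx hz' ⊢ <;> omega

lemma mem_of_index_of_short {o : Square} {m n d : ℕ} (hn : n + d = 2 * m) (hd : d < m) (i j : Fin 8)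
    (h : AlternatingIndex oddIndex i j) (y : Square) (hy : y ∈ frameSection (o - ((d : ℤ), (d : ℤ))) d m j) :
    y + octagon m n i ∈ frameSection o m n i := by
  fin_cases i <;> fin_cases j <;> simp [AlternatingIndex, oddIndex] at h <;>
    simp [frameSection, third, dir, octagon] at hy ⊢ <;> omega

lemma evenIndex_succ : ∀ i, evenIndex (i + 1) = !evenIndex i := by decide

lemma oddIndex_succ : ∀ i, oddIndex (i + 1) = !oddIndex i := by decide

/-! ### The descent. -/

/-- Every square of an `(m, n)`-frame with `m + n` odd is in a proper system of a leaper whose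
proportions have a sum smaller than `m + n`. -/
theorem exists_properSystem (N : ℕ) : ∀ (m n : ℕ) (o : Square), m + n = N → m < n → Odd (m + n) →
    ∀ k, ∀ x ∈ frameSection o m n k, ∃ M : Leaper, M.p + M.q < m + n ∧
      ∃ w, ProperSystem (frameSection o m n) (crossing m n) M.IsMove w ∧ x ∈ w k := by
  induction N using Nat.strong_induction_on with
  | _ N ih =>
  rintro m n o rfl hmn hodd k x hx
  have hm : 0 < m := by
    rcases Nat.eq_zero_or_pos m with rfl | h
    · exfalso
      fin_cases k <;> simp [frameSection, third, dir] at hx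
    · exact h
  by_cases hz : ∀ i, x - octagon m n k + octagon m n i ∈ frameSection o m n i
  · refine ⟨⟨(2 * (m : ℤ) - n).natAbs, m, Or.inr hm⟩, ?_, _,
      properSystem_octagon (z := x - octagon m n k) (by simp) rfl hz, by simp⟩
    simp only
    omega
  have h5 := octagon_add_crossing m n
  have h4 := octagon_succ_add_crossing m n
  rcases le_or_gt n (2 * m) with h | h
  · obtain ⟨d, hd⟩ : ∃ d, n + d = 2 * m := ⟨2 * m - n, by omega⟩
    have hdm : d < m := by omega
    obtain ⟨j, hj, hxj⟩ := exists_index_of_short hd k hx hz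
    obtain ⟨M, hM, w, hw, hxw⟩ := ih (d + m) (by omega) d m _ rfl hdm (by grind) j _ hxj
    refine ⟨M, by omega, _, hw.alternatingLift (isMove_symm M) (isMove_add M) oddIndex oddIndex_succ
      (mem_of_index_of_short hd hdm) h5 h4 ?_ ?_ (crossing_mem hdm.le)
      (frameSection_disjoint hdm.le), mem_alternatingLift.2 ⟨j, hj, _, hxw, by simp⟩⟩
    · intro i hi
      fin_cases i <;> simp [oddIndex] at hi <;>
        simp [octagon, crossing, Prod.ext_iff] <;> omega
    · intro i hi
      fin_cases i <;> simp [oddIndex] at hi <;>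
        simp [octagon, crossing, Prod.ext_iff] <;> omega
  obtain ⟨d, rfl⟩ := Nat.exists_eq_add_of_lt h
  rw [add_assoc] at *
  generalize d + 1 = d at *
  -- If `d = m`, then `n = 3m` and `m + n = 4m` is even.
  have hne : d ≠ m := by
    rintro rfl
    grind
  rcases hne.lt_or_gt with hdm | hdm
  · obtain ⟨j, hj, hxj⟩ := exists_index_of_wide k hx hz
    obtain ⟨M, hM, w, hw, hxw⟩ := ih (d + m) (by omega) d m o rfl hdm (by grind) j _ hxj
    refine ⟨M, by omega, _, hw.wideLift (isMove_symm M) (isMove_add M) evenIndex evenIndex_succ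
      (mem_of_index_of_wide hdm) h5 h4 ?_ ?_ (crossing_mem hdm.le)
      (frameSection_disjoint hdm.le), mem_wideLift.2 ⟨j, hj, _, hxw, by simp⟩⟩
    · intro i hi
      fin_cases i <;> simp [evenIndex] at hi <;> simp [octagon, crossing]
    · intro i hi
      fin_cases i <;> simp [evenIndex] at hi <;> simp [octagon, crossing]
  · obtain ⟨j, hj, hxj⟩ := exists_index_of_long k hx
    obtain ⟨M, hM, w, hw, hxw⟩ := ih (m + d) (by omega) m d o rfl hdm (by grind) j _ hxj
    refine ⟨M, by omega, _, hw.alternatingLift (isMove_symm M) (isMove_add M) evenIndex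
      evenIndex_succ mem_of_index_of_long h5 h4 ?_ ?_ (crossing_mem hdm.le)
      (frameSection_disjoint hdm.le), mem_alternatingLift.2 ⟨j, hj, _, hxw, by simp⟩⟩
    · intro i hi
      fin_cases i <;> simp [evenIndex] at hi <;> simp [octagon, crossing]
    · intro i hi
      fin_cases i <;> simp [evenIndex] at hi <;> simp [octagon, crossing]

/-! ### From proper systems to Hamiltonian cycles. -/

/-- A list without repetitions of all vertices of a graph, at least three of them, in which
cyclically consecutive vertices are adjacent, traces a Hamiltonian cycle. -/
theorem exists_isHamiltonianCycle {V : Type*} [DecidableEq V] {G : SimpleGraph V} {a : V}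
    {t : List V} (hn : (a :: t).Nodup) (hmem : ∀ v, v ∈ a :: t) (hl : 2 ≤ t.length)
    (hc : (a :: t ++ [a]).IsChain G.Adj) :
    ∃ D : G.Walk a a, D.IsHamiltonianCycle ∧ D.support.dropLast = a :: t := by
  obtain ⟨y, t, rfl⟩ : ∃ y s, t = y :: s := by
    cases t with
    | nil => simp at hl
    | cons y s => exact ⟨y, s, rfl⟩
  have hc' : (a :: y :: (t ++ [a])).IsChain G.Adj := by simpa using hc
  rw [List.isChain_cons_cons] at hc'
  obtain ⟨hay, hc'⟩ := hc'
  let p : G.Walk y a := (SimpleGraph.Walk.ofSupport (y :: (t ++ [a])) (by simp) hc').copy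
    (by simp) (by simp)
  have hp : p.support = y :: (t ++ [a]) :=
    (SimpleGraph.Walk.support_copy _ _ _).trans (SimpleGraph.Walk.support_ofSupport _ _)
  have hperm : (y :: (t ++ [a])).Perm (a :: y :: t) := by
    rw [← List.cons_append]
    exact List.perm_append_singleton a (y :: t)
  have hpath : p.IsPath := SimpleGraph.Walk.IsPath.mk' (by rw [hp]; exact hperm.nodup_iff.2 hn)
  have htail : (SimpleGraph.Walk.cons hay p).tail.support = p.support := by simp
  have hpath' : (SimpleGraph.Walk.cons hay p).tail.IsPath :=
    SimpleGraph.Walk.IsPath.mk' (by rw [htail]; exact hpath.support_nodup)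
  refine ⟨SimpleGraph.Walk.cons hay p, ⟨?_, ?_⟩, ?_⟩
  · refine SimpleGraph.Walk.isCycle_iff_isPath_tail_and_le_length.2 ⟨hpath', ?_⟩
    have := congrArg List.length hp
    simp only [SimpleGraph.Walk.length_support, SimpleGraph.Walk.length_cons, List.length_cons,
      List.length_append, List.length_nil] at this hl ⊢
    omega
  · refine hpath'.isHamiltonian_of_mem fun v => ?_
    rw [htail, hp]
    exact hperm.mem_iff.2 (hmem v)
  · rw [SimpleGraph.Walk.support_cons, hp, ← List.cons_append, ← List.cons_append,
      List.dropLast_concat]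

/-- The sequence of a proper system is traced by a Hamiltonian cycle over its squares. -/
theorem ProperSystem.exists_hamiltonianCycle {F : Fin 8 → Set Square} {c : Fin 8 → Square}
    {M : Leaper} {w : Fin 8 → List Square} (hw : ProperSystem F c M.IsMove w)
    (hF : ∀ i j x, x ∈ F i → x ∈ F j → i = j) {S : Set Square}
    (hS : ∀ x, x ∈ S ↔ ∃ i, x ∈ w i) :
    ∃ (b : S) (D : (M.graph S).Walk b b), D.IsHamiltonianCycle ∧
      D.support.dropLast.map Subtype.val = (List.ofFn w).flatten := by
  have hflat : (List.ofFn w).flatten = ([0, 1, 2, 3, 4, 5, 6, 7] : List (Fin 8)).flatMap w := rfl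
  have hnodup : (List.ofFn w).flatten.Nodup := by
    rw [hflat, List.nodup_flatMap]
    refine ⟨fun i _ => hw.nodup i, ?_⟩
    have h : ([0, 1, 2, 3, 4, 5, 6, 7] : List (Fin 8)).Pairwise (· ≠ ·) := by decide
    exact h.imp fun {i j} hij x hi hj => hij (hF i j x (hw.mem i x hi) (hw.mem j x hj))
  have hmem : ∀ x, x ∈ (List.ofFn w).flatten ↔ x ∈ S := by
    intro x
    rw [hS, hflat, List.mem_flatMap]
    exact exists_congr fun i => and_iff_right (by revert i; decide)
  -- Repeating `w 0` at the end records the move that closes the cycle.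
  have hchain : ((List.ofFn w).flatten ++ w 0).IsChain M.IsMove := by
    have := isChain_glue (hw.ne_nil 1) (hw.chain 0) (isChain_glue (hw.ne_nil 2) (hw.chain 1)
      (isChain_glue (hw.ne_nil 3) (hw.chain 2) (isChain_glue (hw.ne_nil 4) (hw.chain 3)
      (isChain_glue (hw.ne_nil 5) (hw.chain 4) (isChain_glue (hw.ne_nil 6) (hw.chain 5)
      (isChain_glue (hw.ne_nil 7) (hw.chain 6) (hw.chain 7)))))))
    simpa [hflat] using this
  have hlen : 8 ≤ (List.ofFn w).flatten.length := by
    have := fun i => List.length_pos_iff.2 (hw.ne_nil i)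
    have h0 := this 0
    have h1 := this 1
    have h2 := this 2
    have h3 := this 3
    have h4 := this 4
    have h5 := this 5
    have h6 := this 6
    have h7 := this 7
    simp
    omega
  obtain ⟨x, s, hx⟩ := List.exists_cons_of_ne_nil (hw.ne_nil 0)
  obtain ⟨t, ht⟩ : ∃ t, (List.ofFn w).flatten = x :: t :=
    ⟨s ++ ([1, 2, 3, 4, 5, 6, 7] : List (Fin 8)).flatMap w, by
      rw [hflat, List.flatMap_cons, hx]; rfl⟩
  rw [ht] at hnodup hchain hlen hmem ⊢
  lift x to S using (hmem x).1 (by simp)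
  lift t to List S using fun y hy => (hmem y).1 (by simp [hy])
  rw [hx] at hchain
  have hc : (x :: t ++ [x]).IsChain (M.graph S).Adj := by
    have : ((x :: t ++ [x]).map Subtype.val).IsChain M.IsMove := by
      refine hchain.prefix ⟨s, ?_⟩
      simp
    exact (List.isChain_map (R := M.IsMove) Subtype.val).1 this
  obtain ⟨D, hD, hs⟩ := exists_isHamiltonianCycle (G := M.graph S) (a := x) (t := t)
    (List.Nodup.of_map Subtype.val (by simpa using hnodup))
    (fun v => by
      have := (hmem v).2 v.2
      simpa [Subtype.ext_iff] using this) (by simp at hlen; omega) hc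
  exact ⟨x, D, hD, by rw [hs]; simp⟩

/-! ### Cycles of `L` as orbits of the crossings. -/

/-- Each of the eight displacements keeps a square on the board only if the square starts in one
particular pair of adjacent sections. -/
lemma isMove_iff_exists_crossing {m n : ℕ} {L : Leaper} (hp : L.p = m) (hq : L.q = n)
    {o x y : Square} (hx : x ∈ regularBoard o (m + n)) (hy : y ∈ regularBoard o (m + n)) :
    L.IsMove x y → ∃ i, x ∈ frameSection o m n i ∪ frameSection o m n (i + 1) ∧
      y = x + crossing m n i := by
  obtain ⟨x1, x2⟩ := x
  obtain ⟨y1, y2⟩ := y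
  simp only [regularBoard, Set.mem_ofPred_eq] at hx hy
  unfold Leaper.IsMove
  rw [hp, hq]
  simp only [abs_eq (Int.natCast_nonneg _)]
  rintro (⟨h1 | h1, h2 | h2⟩ | ⟨h1 | h1, h2 | h2⟩)
  · refine ⟨5, ?_, ?_⟩ <;> simp [frameSection, third, dir, crossing] <;> omega
  · refine ⟨2, ?_, ?_⟩ <;> simp [frameSection, third, dir, crossing] <;> omega
  · refine ⟨6, ?_, ?_⟩ <;> simp [frameSection, third, dir, crossing] <;> omega
  · refine ⟨1, ?_, ?_⟩ <;> simp [frameSection, third, dir, crossing] <;> omega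
  · refine ⟨4, ?_, ?_⟩ <;> simp [frameSection, third, dir, crossing] <;> omega
  · refine ⟨3, ?_, ?_⟩ <;> simp [frameSection, third, dir, crossing] <;> omega
  · refine ⟨7, ?_, ?_⟩ <;> simp [frameSection, third, dir, crossing] <;> omega
  · refine ⟨0, ?_, ?_⟩ <;> simp [frameSection, third, dir, crossing] <;> omega

/-- In a graph where every vertex of the section `F k` has no neighbors besides its translates by
`c k` and `c (k + 7)`, the squares of a cycle are closed under the translations. -/
lemma squaresOf_closed {B : Set Square} {G : SimpleGraph B} {F : Fin 8 → Set Square}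
    {c : Fin 8 → Square} (hF : ∀ i j x, x ∈ F i → x ∈ F j → i = j)
    (hG : ∀ x y, G.Adj x y → ∃ i, (x : Square) ∈ F i ∪ F (i + 1) ∧ (y : Square) = x + c i)
    {a : B} {C : G.Walk a a} (hC : C.IsCycle) (i : Fin 8) (x : Square)
    (hx : x ∈ F i ∪ F (i + 1)) (hxC : x ∈ squaresOf C) : x + c i ∈ squaresOf C := by
  obtain ⟨v, hv, rfl⟩ := hxC
  have index : ∀ k, (v : Square) ∈ F k → ∀ j, (v : Square) ∈ F j ∪ F (j + 1) →
      j = k ∨ j = k + 7 := by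
    rintro k hk j (hj | hj)
    · exact Or.inl (hF _ _ _ hj hk)
    · right
      rw [← hF _ _ _ hj hk, add_assoc]
      exact (add_zero j).symm
  obtain ⟨k, hk⟩ : ∃ k, (v : Square) ∈ F k := hx.elim (fun h => ⟨i, h⟩) fun h => ⟨i + 1, h⟩
  have hcard := hC.ncard_neighborSet_toSubgraph_eq_two hv
  have hsub : Subtype.val '' C.toSubgraph.neighborSet v ⊆
      {(v : Square) + c k, (v : Square) + c (k + 7)} := by
    rintro _ ⟨y, hy, rfl⟩
    obtain ⟨j, hj, e⟩ := hG v y (C.toSubgraph.adj_sub hy)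
    rw [e]
    rcases index k hk j hj with rfl | rfl <;> simp
  -- The two neighbours on the cycle lie among two candidates, so they are both candidates; in
  -- particular both translates are squares of `C`.
  have heq := Set.eq_of_subset_of_ncard_le hsub (by
    rw [Set.ncard_image_of_injective _ Subtype.val_injective, hcard]
    exact (Set.ncard_insert_le _ _).trans (by simp)) (Set.toFinite _)
  have hin : (v : Square) + c i ∈ Subtype.val '' C.toSubgraph.neighborSet v := by
    rw [heq]
    rcases index k hk i hx with rfl | rfl <;> simp
  obtain ⟨y, hy, e⟩ := hin
  exact ⟨y, (C.mem_verts_toSubgraph).1 (C.toSubgraph.edge_vert hy.symm), e⟩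

/-- A set of vertices that is closed under adjacency and contains the start of a walk contains all
vertices of the walk. -/
lemma support_subset_of_closed {V : Type*} {G : SimpleGraph V} {P : V → Prop}
    (hP : ∀ x y, G.Adj x y → P x → P y) {u v : V} (C : G.Walk u v) (hu : P u) :
    ∀ x ∈ C.support, P x := by
  induction C with
  | nil => simpa using hu
  | cons h p ih =>
    intro x hx
    rcases List.mem_cons.1 (SimpleGraph.Walk.support_cons h p ▸ hx) with rfl | hx
    · exact hu
    · exact ih (hP _ _ h hu) x hx

theorem theorem1 (L : Leaper) (hodd : Odd (L.p + L.q)) (o : Square)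
    (a : regularBoard o (L.p + L.q))
    (C : (L.graph (regularBoard o (L.p + L.q))).Walk a a) (hC : C.IsCycle) :
    ∃ M : Leaper, ¬ M.SamePiece L ∧ M.p + M.q < L.p + L.q ∧
      ∃ (b : squaresOf C) (D : (M.graph (squaresOf C)).Walk b b),
        D.IsHamiltonianCycle ∧ IsProper o (min L.p L.q) (max L.p L.q) D := by
  have hmn : min L.p L.q < max L.p L.q := by grind
  have hsum : min L.p L.q + max L.p L.q = L.p + L.q := min_add_max _ _
  have hG : ∀ x y, (L.graph (regularBoard o (L.p + L.q))).Adj x y →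
      ∃ i, (x : Square) ∈ frameSection o (min L.p L.q) (max L.p L.q) i ∪
          frameSection o (min L.p L.q) (max L.p L.q) (i + 1) ∧
        (y : Square) = x + crossing (min L.p L.q) (max L.p L.q) i := by
    intro x y h
    refine isMove_iff_exists_crossing (L := ⟨min L.p L.q, max L.p L.q, by omega⟩) rfl rfl
      (by rw [hsum]; exact x.2) (by rw [hsum]; exact y.2) ?_
    change L.IsMove x y at h
    rcases le_total L.p L.q with hle | hle
    · simpa only [Leaper.IsMove, min_eq_left hle, max_eq_right hle] using h
    · simpa only [Leaper.IsMove, min_eq_right hle, max_eq_left hle] using Or.symm h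
  rw [← hsum] at hodd
  generalize min L.p L.q = m at *
  generalize max L.p L.q = n at *
  have hF := frameSection_disjoint (o := o) hmn.le
  -- The start of the cycle has a move, so it is not in the hole.
  obtain ⟨k, hk⟩ : ∃ k, (a : Square) ∈ frameSection o m n k := by
    cases C with
    | nil => exact absurd hC (by simp)
    | cons h p =>
      obtain ⟨i, hi | hi, -⟩ := hG _ _ h
      exacts [⟨i, hi⟩, ⟨i + 1, hi⟩]
  obtain ⟨M, hM, w, hw, haw⟩ := exists_properSystem _ m n o rfl hmn hodd k a hk
  -- The walk cannot leave the system, which `cross` makes closed under moves of `L`; conversely the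
  -- system is a single orbit, and the squares of `C` are closed under crossings.
  have hS : ∀ x, x ∈ squaresOf C ↔ ∃ i, x ∈ w i := by
    intro x
    constructor
    · rintro ⟨y, hy, rfl⟩
      refine support_subset_of_closed
        (P := fun y : regularBoard o (L.p + L.q) => ∃ i, (y : Square) ∈ w i) ?_ C ⟨k, haw⟩ y hy
      rintro x y hxy ⟨j, hj⟩
      obtain ⟨i, hi, e⟩ := hG x y hxy
      have hx : (x : Square) ∈ w i ++ w (i + 1) := by
        rw [List.mem_append]
        rcases hi with hi | hi
        · exact Or.inl (hF _ _ _ (hw.mem j _ hj) hi ▸ hj)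
        · exact Or.inr (hF _ _ _ (hw.mem j _ hj) hi ▸ hj)
      have := hw.cross i ▸ mem_shift.2 ⟨_, hx, e.symm⟩
      rw [List.mem_append, List.mem_reverse, List.mem_reverse] at this
      exact this.elim (fun h => ⟨_, h⟩) fun h => ⟨_, h⟩
    · rintro ⟨i, hi⟩
      exact hw.orbit (· ∈ squaresOf C) (fun i x hx h => squaresOf_closed hF hG hC i x hx h)
        ⟨k, a, haw, a, C.start_mem_support, rfl⟩ i x hi
  obtain ⟨b, D, hD, hs⟩ := hw.exists_hamiltonianCycle hF hS
  refine ⟨M, ?_, hsum ▸ hM, b, D, hD, w, Or.inl (hs ▸ List.IsRotated.refl _), hw.ne_nil, hw.mem,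
    hw.cross⟩
  -- Equal pieces would have equal sums of proportions.
  unfold Leaper.SamePiece
  omega
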